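/- Let $\Omega_{\mathcal U}\subset\mathbb R^{d_{\mathcal U}}$ and $\Omega_{\mathcal V}\subset\mathbb R^{d_{\mathcal V}}$ be compact, and suppose that every nonempty relatively open subset of $\Omega_{\mathcal U}$ has positive Lebesgue measure (as is the case for the closure of a bounded domain). Let $\mathcal U\subset C(\Omega_{\mathcal U})$ be compact, let $\mathcal V=C(\Omega_{\mathcal V})$, and let $G^\dagger:\mathcal U\to\mathcal V$ be continuous, where both spaces of real-valued continuous functions carry the supremum norm. Let $\sigma,\tau:\mathbb R\to\mathbb R$ be continuous Tauber–Wiener functions; here $g:\mathbb R\to\mathbb R$ is called Tauber–Wiener if the finite linear combinations $x\mapsto\sum_i c_i\,g(\lambda_i x+\theta_i)$ with $c_i,\lambda_i,\theta_i\in\mathbb R$ are uniformly dense in $C[a,b]$ for every compact interval $[a,b]$. A one-hidden-layer network $\mathbb R^n\to\mathbb R^m$ with activation $g$ is a map $x\mapsto C\,g(Wx+b)$ with $W\in\mathbb R^{N\times n}$, $b\in\mathbb R^N$, $C\in\mathbb R^{m\times N}$ for some $N$, where $g$ acts componentwise. Then for every $\varepsilon>0$ there exist $p,q\in\mathbb N$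 and one-hidden-layer networks $\Phi^E:\mathbb R^{d_{\mathcal U}}\to\mathbb R^p$ with activation $\tau$, and $\Phi^A:\mathbb R^p\to\mathbb R^q$ and $\Phi^R:\mathbb R^{d_{\mathcal V}}\to\mathbb R^q$ with activation $\sigma$, such that the model $G_{\rm ours}=R\circ A\circ E$ with $$E(u)=\Big(\int_{\Omega_{\mathcal U}}\Phi^E_j(x)\,u(x)\,dx\Big)_{j=1}^p,\qquad A(z)=\Phi^A(z),\qquad R(w)=\sum_{j=1}^q w_j\,\Phi^R_j\big|_{\Omega_{\mathcal V}}$$ satisfies $$\big|G^\dagger(u)(y)-G_{\rm ours}(u)(y)\big|<\varepsilon\qquad\text{for all }u\in\mathcal U\text{ and all }y\in\Omega_{\mathcal V}.$$ -/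

import Mathlib

open MeasureTheory

noncomputable section

/-- Tauber-Wiener function: the finite linear combinations of the functions
`x ↦ g (l * x + t)` are uniformly dense in `C[a, b]` for every compact interval `[a, b]`. -/
def IsTauberWiener (g : ℝ → ℝ) : Prop :=
  ∀ a b : ℝ, ∀ f : ℝ → ℝ, ContinuousOn f (Set.Icc a b) → ∀ ε : ℝ, 0 < ε →
    ∃ (n : ℕ) (c l t : Fin n → ℝ),
      ∀ x ∈ Set.Icc a b, |f x - ∑ i, c i * g (l i * x + t i)| < ε

/-- Parameters of a neural network `ℝⁿ → ℝᵐ` with one hidden layer (of arbitrary finite width). -/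
structure ShallowNet (n m : ℕ) where
  width : ℕ
  innerWeight : Matrix (Fin width) (Fin n) ℝ
  innerBias : Fin width → ℝ
  outerWeight : Matrix (Fin m) (Fin width) ℝ

/-- The `k`-th output of the network with activation `σ`, a continuous function on `ℝⁿ`. -/
def ShallowNet.component {n m : ℕ} (σ : C(ℝ, ℝ)) (Φ : ShallowNet n m) (k : Fin m) :
    C(EuclideanSpace ℝ (Fin n), ℝ) where
  toFun x := ∑ i, Φ.outerWeight k i * σ ((∑ j, Φ.innerWeight i j * x j) + Φ.innerBias i)
  continuous_toFun := by fun_prop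

/-- The function `ℝⁿ → ℝᵐ`, `x ↦ C σ(W x + b)`, realised by the network. -/
def ShallowNet.eval {n m : ℕ} (σ : C(ℝ, ℝ)) (Φ : ShallowNet n m)
    (x : EuclideanSpace ℝ (Fin n)) : EuclideanSpace ℝ (Fin m) :=
  WithLp.toLp 2 fun k => Φ.component σ k x

/-- Parameters of an encode-approximate-reconstruct model with latent dimensions `p` and `q`:
the encoder basis network, the approximator network and the reconstructor basis network. -/
structure EARModel (dU dV p q : ℕ) where
  netE : ShallowNet dU p
  netA : ShallowNet p q
  netR : ShallowNet dV q

namespace EARModel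

variable {dU dV p q : ℕ}

/-- Encoder: the inner products `∫_{Ω} Φᴱ_j u` (Lebesgue measure), for `j = 1, …, p`. -/
def encoder (τ : C(ℝ, ℝ)) (M : EARModel dU dV p q) (ΩU : Set (EuclideanSpace ℝ (Fin dU)))
    (u : C(ΩU, ℝ)) : EuclideanSpace ℝ (Fin p) :=
  WithLp.toLp 2 fun j =>
    ∫ x : ΩU, M.netE.component τ j (x : EuclideanSpace ℝ (Fin dU)) * u x
      ∂(Measure.comap Subtype.val volume)

/-- Approximator: the network `Φᴬ`. -/
def approximator (σ : C(ℝ, ℝ)) (M : EARModel dU dV p q) (z : EuclideanSpace ℝ (Fin p)) :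
    EuclideanSpace ℝ (Fin q) :=
  M.netA.eval σ z

/-- Reconstructor: `w ↦ ∑ j, w_j Φᴿ_j`, as an element of `C(Ω)`. -/
def reconstructor (σ : C(ℝ, ℝ)) (M : EARModel dU dV p q)
    (ΩV : Set (EuclideanSpace ℝ (Fin dV))) (w : EuclideanSpace ℝ (Fin q)) : C(ΩV, ℝ) :=
  ∑ j, w j • (M.netR.component σ j).restrict ΩV

/-- The model operator `R ∘ A ∘ E`; the encoder network has activation `τ`, the approximator
and reconstructor networks share the activation `σ`. -/
def toOperator (σ τ : C(ℝ, ℝ)) (M : EARModel dU dV p q)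
    (ΩU : Set (EuclideanSpace ℝ (Fin dU))) (ΩV : Set (EuclideanSpace ℝ (Fin dV))) :
    C(ΩU, ℝ) → C(ΩV, ℝ) :=
  M.reconstructor σ ΩV ∘ M.approximator σ ∘ M.encoder τ ΩU

end EARModel

end

/-! The map `(u, y) ↦ G u y` is continuous on the compact space `U × ΩV`, so it suffices to show
that the model's outputs `∑ i, a i * σ (∫ e i * u + s i) * r i y` are uniformly dense there. The
engine is `IsTauberWiener.span_shiftedComps_dense`, used three times. With `τ` on `ΩU` it makes the
encoder functions `e` dense, so the functionals `u ↦ ∫ e u` separate points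
(`exists_integralPairing_ne`). With `σ` it then applies to these functionals on `U`, and to linear
functionals on `ΩV`. `span_prodMul_dense` combines the last two. -/

/-- Stone-Weierstrass for the linear span of a multiplicative monoid of functions. -/
theorem span_submonoid_topologicalClosure_eq_top {X : Type*} [TopologicalSpace X] [CompactSpace X]
    (N : Submonoid C(X, ℝ)) (hN : ∀ x y : X, x ≠ y → ∃ f ∈ N, f x ≠ f y) :
    (Submodule.span ℝ (N : Set C(X, ℝ))).topologicalClosure = ⊤ := by
  have h := ContinuousMap.subalgebra_topologicalClosure_eq_top_of_separatesPoints
    (Algebra.adjoin ℝ (N : Set C(X, ℝ))) (by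
      intro x y hxy
      obtain ⟨f, hf, hne⟩ := hN x y hxy
      exact ⟨f, ⟨f, Algebra.subset_adjoin hf, rfl⟩, hne⟩)
  have hspan : Subalgebra.toSubmodule (Algebra.adjoin ℝ (N : Set C(X, ℝ))) =
      Submodule.span ℝ (N : Set C(X, ℝ)) := by
    rw [Algebra.adjoin_eq_span, Submonoid.closure_eq]
  rw [← Submodule.dense_iff_topologicalClosure_eq_top, ← hspan]
  intro f
  have : f ∈ (Algebra.adjoin ℝ (N : Set C(X, ℝ))).topologicalClosure := h ▸ trivial
  exact this

/-- The functions `x ↦ g (f x + t)` with `f` in a given space `V` of continuous functions. -/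
def shiftedComps {X : Type*} [TopologicalSpace X] (g : C(ℝ, ℝ)) (V : Submodule ℝ C(X, ℝ)) :
    Set C(X, ℝ) :=
  {h | ∃ f ∈ V, ∃ t : ℝ, ∀ x, h x = g (f x + t)}

theorem IsTauberWiener.comp_mem_closure_span {X : Type*} [TopologicalSpace X] [CompactSpace X]
    {g : C(ℝ, ℝ)} (hg : IsTauberWiener g) (V : Submodule ℝ C(X, ℝ)) {f : C(X, ℝ)} (hf : f ∈ V)
    (h : C(ℝ, ℝ)) :
    h.comp f ∈ (Submodule.span ℝ (shiftedComps g V)).topologicalClosure := by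
  rw [← SetLike.mem_coe, Submodule.topologicalClosure_coe, Metric.mem_closure_iff]
  intro ε hε
  -- The interval contains the range of `f`; `ε / 2` is used because `dist_le` yields only a weak
  -- inequality.
  obtain ⟨n, c, l, t, hn⟩ := hg (-‖f‖) ‖f‖ h h.continuous.continuousOn (ε / 2) (half_pos hε)
  let k : Fin n → C(X, ℝ) := fun i => ⟨fun x => g (l i * f x + t i), by fun_prop⟩
  refine ⟨∑ i, c i • k i, Submodule.sum_mem _ fun i _ => Submodule.smul_mem _ _
    (Submodule.subset_span ⟨l i • f, V.smul_mem _ hf, t i, fun x => rfl⟩), ?_⟩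
  refine lt_of_le_of_lt ((ContinuousMap.dist_le (half_pos hε).le).2 fun x => ?_) (half_lt_self hε)
  have hx := hn (f x) (abs_le.1 (f.norm_coe_le_norm x))
  simpa [Real.dist_eq, k] using hx.le

/-- Universal approximation: the compositions of a Tauber-Wiener function with shifts of a
point-separating space of functions span a dense subspace. -/
theorem IsTauberWiener.span_shiftedComps_dense {X : Type*} [TopologicalSpace X] [CompactSpace X]
    {g : C(ℝ, ℝ)} (hg : IsTauberWiener g) (V : Submodule ℝ C(X, ℝ))
    (hV : ∀ x y : X, x ≠ y → ∃ f ∈ V, f x ≠ f y) :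
    (Submodule.span ℝ (shiftedComps g V)).topologicalClosure = ⊤ := by
  -- The exponential turns addition in `V` into multiplication, so the functions `exp ∘ f` form a
  -- monoid, and it is injective, so they still separate points.
  let e : C(ℝ, ℝ) := ⟨Real.exp, Real.continuous_exp⟩
  let N : Submonoid C(X, ℝ) :=
    { carrier := {h | ∃ f ∈ V, h = e.comp f}
      one_mem' := ⟨0, V.zero_mem, by ext; simp [e]⟩
      mul_mem' := by
        rintro _ _ ⟨f, hf, rfl⟩ ⟨f', hf', rfl⟩
        exact ⟨f + f', V.add_mem hf hf', by ext; simp [e, Real.exp_add]⟩ }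
  rw [eq_top_iff, ← span_submonoid_topologicalClosure_eq_top N fun x y hxy => by
    obtain ⟨f, hf, hne⟩ := hV x y hxy
    exact ⟨e.comp f, ⟨f, hf, rfl⟩, fun h => hne (Real.exp_injective h)⟩]
  refine Submodule.topologicalClosure_minimal _ (Submodule.span_le.2 ?_)
    (Submodule.isClosed_topologicalClosure _)
  rintro _ ⟨f, hf, rfl⟩
  exact hg.comp_mem_closure_span V hf e

theorem exists_continuousMap_ne {X : Type*} [TopologicalSpace X] [CompactSpace X] [T2Space X]
    {x y : X} (hxy : x ≠ y) : ∃ f : C(X, ℝ), f x ≠ f y := by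
  obtain ⟨f, h0, h1, -⟩ := exists_continuous_zero_one_of_isClosed (isClosed_singleton (x := x))
    (isClosed_singleton (x := y)) (by simpa using hxy)
  exact ⟨f, by simp [h0 rfl, h1 rfl]⟩

/-- Products of functions from total sets form a total set in the functions on a product. -/
theorem span_prodMul_dense {X Y : Type*} [TopologicalSpace X] [CompactSpace X] [T2Space X]
    [TopologicalSpace Y] [CompactSpace Y] [T2Space Y] {S : Set C(X, ℝ)} {T : Set C(Y, ℝ)}
    (hS : (Submodule.span ℝ S).topologicalClosure = ⊤)
    (hT : (Submodule.span ℝ T).topologicalClosure = ⊤) :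
    (Submodule.span ℝ {h | ∃ f ∈ S, ∃ k ∈ T,
      h = ContinuousMap.prodMul (R := ℝ) f k}).topologicalClosure = ⊤ := by
  set M := (Submodule.span ℝ {h | ∃ f ∈ S, ∃ k ∈ T,
      h = ContinuousMap.prodMul (R := ℝ) f k}).topologicalClosure
  have hMc : IsClosed (M : Set C(X × Y, ℝ)) := Submodule.isClosed_topologicalClosure _
  -- Density is used one factor at a time: with the other factor fixed, the preimage of `M` is a
  -- closed subspace.
  have h1 : ∀ k ∈ T, ∀ f : C(X, ℝ), ContinuousMap.prodMul (R := ℝ) f k ∈ M := by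
    intro k hk
    have hle : (Submodule.span ℝ S).topologicalClosure ≤
        M.comap ((ContinuousMap.prodMul (R := ℝ)).flip k) := by
      refine Submodule.topologicalClosure_minimal _ (Submodule.span_le.2 fun f hf => ?_) ?_
      · exact Submodule.le_topologicalClosure _ (Submodule.subset_span ⟨f, hf, k, hk, rfl⟩)
      · exact hMc.preimage (f := fun f : C(X, ℝ) =>
          f.comp ContinuousMap.fst * k.comp ContinuousMap.snd) (by fun_prop)
    exact fun f => hle (hS ▸ trivial)
  have h2 : ∀ (f : C(X, ℝ)) (k : C(Y, ℝ)), ContinuousMap.prodMul (R := ℝ) f k ∈ M := by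
    intro f
    have hle : (Submodule.span ℝ T).topologicalClosure ≤
        M.comap (ContinuousMap.prodMul (R := ℝ) f) := by
      refine Submodule.topologicalClosure_minimal _ (Submodule.span_le.2 fun k hk => h1 k hk f) ?_
      exact hMc.preimage (f := fun k : C(Y, ℝ) =>
          f.comp ContinuousMap.fst * k.comp ContinuousMap.snd) (by fun_prop)
    exact fun k => hle (hT ▸ trivial)
  let N : Submonoid C(X × Y, ℝ) :=
    { carrier := {h | ∃ f k, h = ContinuousMap.prodMul (R := ℝ) f k}
      one_mem' := ⟨1, 1, by ext; simp⟩
      mul_mem' := by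
        rintro _ _ ⟨f, k, rfl⟩ ⟨f', k', rfl⟩
        exact ⟨f * f', k * k', by ext; simp; ring⟩ }
  rw [eq_top_iff, ← span_submonoid_topologicalClosure_eq_top N]
  · refine Submodule.topologicalClosure_minimal _ (Submodule.span_le.2 ?_) hMc
    rintro _ ⟨f, k, rfl⟩
    exact h2 f k
  · rintro ⟨x, y⟩ ⟨x', y'⟩ hne
    by_cases hx : x = x'
    · obtain ⟨k, hk⟩ := exists_continuousMap_ne fun h : y = y' => hne (by rw [hx, h])
      exact ⟨_, ⟨1, k, rfl⟩, by simpa using hk⟩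
    · obtain ⟨f, hf⟩ := exists_continuousMap_ne hx
      exact ⟨_, ⟨f, 1, rfl⟩, by simpa using hf⟩

/-- The restrictions to `Ω` of the linear functionals on `ℝⁿ`. -/
def linearFunctionals {n : ℕ} (Ω : Set (EuclideanSpace ℝ (Fin n))) : Submodule ℝ C(Ω, ℝ) where
  carrier := {f | ∃ w : Fin n → ℝ, ∀ x : Ω, f x = ∑ j, w j * (x : EuclideanSpace ℝ (Fin n)) j}
  zero_mem' := ⟨0, fun x => by simp⟩
  add_mem' := by
    rintro f f' ⟨w, hw⟩ ⟨w', hw'⟩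
    exact ⟨w + w', fun x => by simp [hw, hw', add_mul, Finset.sum_add_distrib]⟩
  smul_mem' := by
    rintro c f ⟨w, hw⟩
    exact ⟨c • w, fun x => by simp [hw, Finset.mul_sum, mul_assoc]⟩

theorem exists_mem_linearFunctionals_ne {n : ℕ} {Ω : Set (EuclideanSpace ℝ (Fin n))} (x y : Ω)
    (hxy : x ≠ y) : ∃ f ∈ linearFunctionals Ω, f x ≠ f y := by
  by_contra! h
  refine hxy (Subtype.ext (PiLp.ext fun j => ?_))
  exact h ⟨fun x : Ω => (x : EuclideanSpace ℝ (Fin n)) j, by fun_prop⟩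
    ⟨Pi.single j 1, fun x => by simp [Pi.single_apply]⟩

theorem exists_shallow_of_mem_span {n : ℕ} {Ω : Set (EuclideanSpace ℝ (Fin n))} {g : C(ℝ, ℝ)}
    {e : C(Ω, ℝ)} (he : e ∈ Submodule.span ℝ (shiftedComps g (linearFunctionals Ω))) :
    ∃ (N : ℕ) (W : Fin N → Fin n → ℝ) (b c : Fin N → ℝ), ∀ x : Ω,
      e x = ∑ i, c i * g ((∑ j, W i j * (x : EuclideanSpace ℝ (Fin n)) j) + b i) := by
  obtain ⟨N, c, k, rfl⟩ := Submodule.mem_span_set'.1 he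
  choose f hf t ht using fun i => (k i).2
  choose W hW using hf
  exact ⟨N, W, t, c, fun x => by simp [ht, hW]⟩

/-- A network whose components on `Ω` are prescribed elements of the span of ridge functions. -/
theorem exists_shallowNet_component_eq {n m : ℕ} {Ω : Set (EuclideanSpace ℝ (Fin n))}
    {g : C(ℝ, ℝ)} (e : Fin m → C(Ω, ℝ))
    (he : ∀ k, e k ∈ Submodule.span ℝ (shiftedComps g (linearFunctionals Ω))) :
    ∃ Φ : ShallowNet n m, ∀ k (x : Ω), Φ.component g k x = e k x := by
  choose N W b c h using fun k => exists_shallow_of_mem_span (he k)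
  -- The hidden layers are stacked, and output `k` reads only its own block.
  let φ : ((k : Fin m) × Fin (N k)) ≃ Fin (∑ k, N k) := finSigmaFinEquiv
  refine ⟨⟨∑ k, N k, fun i => W (φ.symm i).1 (φ.symm i).2, fun i => b (φ.symm i).1 (φ.symm i).2,
    fun k i => if (φ.symm i).1 = k then c (φ.symm i).1 (φ.symm i).2 else 0⟩, fun k x => ?_⟩
  rw [h]
  simp only [ShallowNet.component, ContinuousMap.coe_mk]
  rw [← φ.sum_comp, Fintype.sum_sigma, Finset.sum_eq_single k]
  · refine Finset.sum_congr rfl fun i _ => ?_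
    rw [φ.symm_apply_apply]
    simp
  · intro k' _ hk
    simp [hk]
  · simp

section Pairing

variable {X : Type*} [TopologicalSpace X] [CompactSpace X] [MeasurableSpace X]
  [OpensMeasurableSpace X] (μ : Measure X) [IsFiniteMeasure μ]

theorem ContinuousMap.integrable_of_compactSpace (f : C(X, ℝ)) : Integrable f μ :=
  f.continuous.integrable_of_hasCompactSupport (HasCompactSupport.of_compactSpace f)

/-- The functional `u ↦ ∫ e u`. -/
noncomputable def integralPairing (e : C(X, ℝ)) : C(X, ℝ) →L[ℝ] ℝ :=
  LinearMap.mkContinuous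
    { toFun := fun u => ∫ x, e x * u x ∂μ
      map_add' := fun u v => by
        simp only [ContinuousMap.add_apply, mul_add]
        exact integral_add ((e * u).integrable_of_compactSpace μ)
          ((e * v).integrable_of_compactSpace μ)
      map_smul' := fun c u => by
        simp only [ContinuousMap.smul_apply, smul_eq_mul, mul_left_comm _ c, RingHom.id_apply]
        exact integral_const_mul _ _ }
    (‖e‖ * μ.real Set.univ) fun u => by
      have h := norm_integral_le_of_norm_le_const (μ := μ) (f := fun x => e x * u x)
        (C := ‖e‖ * ‖u‖) (Filter.Eventually.of_forall fun x => by
          rw [norm_mul]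
          exact mul_le_mul (e.norm_coe_le_norm x) (u.norm_coe_le_norm x) (norm_nonneg _)
            (norm_nonneg _))
      calc _ ≤ _ := h
        _ = _ := by ring

@[simp] theorem integralPairing_apply (e u : C(X, ℝ)) :
    integralPairing μ e u = ∫ x, e x * u x ∂μ := rfl

theorem integralPairing_comm (e u : C(X, ℝ)) : integralPairing μ e u = integralPairing μ u e := by
  simp [mul_comm]

/-- The restrictions to `U` of the functionals `u ↦ ∫ e u`, as a linear function of `e`. -/
noncomputable def integralPairingOn (U : Set C(X, ℝ)) : C(X, ℝ) →ₗ[ℝ] C(U, ℝ) where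
  toFun e := ⟨fun u => integralPairing μ e u, by fun_prop⟩
  map_add' e e' := by
    ext u
    simp only [ContinuousMap.coe_mk, ContinuousMap.add_apply, integralPairing_comm μ _ u.1, map_add]
  map_smul' c e := by
    ext u
    simp only [ContinuousMap.coe_mk, ContinuousMap.smul_apply, integralPairing_comm μ _ u.1,
      map_smul, RingHom.id_apply]

/-- Integration against a total set of functions separates continuous functions. -/
theorem exists_integralPairing_ne [μ.IsOpenPosMeasure] {E : Submodule ℝ C(X, ℝ)}
    (hE : E.topologicalClosure = ⊤) {u v : C(X, ℝ)} (huv : u ≠ v) :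
    ∃ e ∈ E, integralPairing μ e u ≠ integralPairing μ e v := by
  by_contra! h
  -- If all of `E` is orthogonal to `u - v`, so is its closure, which contains `u - v`; hence `∫ (u
  -- - v)² = 0`.
  have hker : E.topologicalClosure ≤ (integralPairing μ (u - v)).toLinearMap.ker := by
    refine Submodule.topologicalClosure_minimal _ (fun e he => ?_)
      (integralPairing μ (u - v)).isClosed_ker
    rw [LinearMap.mem_ker, ContinuousLinearMap.coe_coe, integralPairing_comm, map_sub, h e he,
      sub_self]
  have h0 : integralPairing μ (u - v) (u - v) = 0 := hker (hE ▸ Submodule.mem_top)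
  obtain ⟨x, hx⟩ := DFunLike.ne_iff.1 huv
  have hpos := integral_pos_of_integrable_nonneg_nonzero (μ := μ) (x := x)
    ((u - v) * (u - v)).continuous (((u - v) * (u - v)).integrable_of_compactSpace μ)
    (fun x => mul_self_nonneg _) (mul_self_ne_zero.2 (sub_ne_zero.2 hx))
  exact hpos.ne' h0

end Pairing

/-- This lets a vanishing `∫ (u - v)²` force `u = v` on `ΩU`. -/
theorem isOpenPosMeasure_comap_subtype {n : ℕ} {Ω : Set (EuclideanSpace ℝ (Fin n))}
    (hΩ : MeasurableSet Ω)
    (hpos : ∀ x ∈ Ω, ∀ r : ℝ, 0 < r → 0 < volume (Ω ∩ Metric.ball x r)) :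
    (Measure.comap (Subtype.val : Ω → EuclideanSpace ℝ (Fin n)) volume).IsOpenPosMeasure := by
  refine ⟨fun V hV ⟨x, hx⟩ => ?_⟩
  obtain ⟨r, hr, hball⟩ := Metric.isOpen_iff.1 hV x hx
  refine ((hpos x x.2 r hr).trans_le ?_).ne'
  rw [comap_subtype_coe_apply hΩ]
  exact measure_mono fun y hy => ⟨⟨y, hy.1⟩, hball hy.2, rfl⟩

theorem isFiniteMeasure_comap_subtype {n : ℕ} {Ω : Set (EuclideanSpace ℝ (Fin n))}
    (hΩ : IsCompact Ω) :
    IsFiniteMeasure (Measure.comap (Subtype.val : Ω → EuclideanSpace ℝ (Fin n)) volume) := by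
  refine ⟨?_⟩
  rw [comap_subtype_coe_apply hΩ.measurableSet]
  simpa using hΩ.measure_lt_top

theorem mainTheorem1 (dU dV : ℕ)
    (ΩU : Set (EuclideanSpace ℝ (Fin dU))) (ΩV : Set (EuclideanSpace ℝ (Fin dV)))
    (hΩU : IsCompact ΩU) (hΩV : IsCompact ΩV)
    (hΩU_pos : ∀ x ∈ ΩU, ∀ r : ℝ, 0 < r → 0 < volume (ΩU ∩ Metric.ball x r))
    (σ τ : C(ℝ, ℝ)) (hσ : IsTauberWiener σ) (hτ : IsTauberWiener τ)
    (U : Set C(ΩU, ℝ)) (hU : IsCompact U)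
    (G : U → C(ΩV, ℝ)) (hG : Continuous G)
    (ε : ℝ) (hε : 0 < ε) :
    ∃ (p q : ℕ) (M : EARModel dU dV p q),
      ∀ (u : U) (y : ΩV), |G u y - M.toOperator σ τ ΩU ΩV (u : C(ΩU, ℝ)) y| < ε := by
  have := isCompact_iff_compactSpace.1 hΩU
  have := isCompact_iff_compactSpace.1 hΩV
  have := isCompact_iff_compactSpace.1 hU
  have := isFiniteMeasure_comap_subtype hΩU
  have := isOpenPosMeasure_comap_subtype hΩU.measurableSet hΩU_pos
  set μ := Measure.comap (Subtype.val : ΩU → EuclideanSpace ℝ (Fin dU)) volume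
  have hE := hτ.span_shiftedComps_dense (linearFunctionals ΩU) exists_mem_linearFunctionals_ne
  set E := Submodule.span ℝ (shiftedComps τ (linearFunctionals ΩU))
  have hS := hσ.span_shiftedComps_dense (E.map (integralPairingOn μ U)) fun u v huv => by
    obtain ⟨e, he, hne⟩ := exists_integralPairing_ne μ hE (Subtype.coe_ne_coe.2 huv)
    exact ⟨_, Submodule.mem_map_of_mem he, hne⟩
  have hT := hσ.span_shiftedComps_dense (linearFunctionals ΩV) exists_mem_linearFunctionals_ne
  have hD := span_prodMul_dense hS hT
  rw [← Submodule.dense_iff_topologicalClosure_eq_top] at hD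
  let F : C(U × ΩV, ℝ) := ⟨fun z => G z.1 z.2, by fun_prop⟩
  obtain ⟨P, hP, hFP⟩ := Metric.mem_closure_iff.1 (hD F) ε hε
  obtain ⟨p, a, k, rfl⟩ := Submodule.mem_span_set'.1 hP
  -- Each summand factors as `σ (f' i + s i)` times a ridge function `r i`, where `f' i` is the
  -- pairing with `e i`.
  choose f hf r hr hk using fun i => (k i).2
  choose f' hf' s hs using hf
  choose e he hef using hf'
  obtain ⟨ΦE, hΦE⟩ := exists_shallowNet_component_eq e he
  obtain ⟨ΦR, hΦR⟩ := exists_shallowNet_component_eq r fun i => Submodule.subset_span (hr i)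
  -- One latent coordinate per summand: the approximator applies `σ (· + s i)` coordinatewise and
  -- scales by `a i`.
  refine ⟨p, p, ⟨ΦE, ⟨p, 1, s, Matrix.diagonal a⟩, ΦR⟩, fun u y => ?_⟩
  have henc : ∀ i, ∫ x : ΩU, ΦE.component τ i x * (u : C(ΩU, ℝ)) x ∂μ = f' i u := fun i => by
    simp only [hΦE, ← hef]
    rfl
  have hnet : EARModel.toOperator σ τ ⟨ΦE, ⟨p, 1, s, Matrix.diagonal a⟩, ΦR⟩ ΩU ΩV
      (u : C(ΩU, ℝ)) y = (∑ i, a i • (k i : C(U × ΩV, ℝ))) (u, y) := by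
    simp [EARModel.toOperator, EARModel.reconstructor, EARModel.approximator, EARModel.encoder,
      ShallowNet.eval, hk, hs, hΦR]
    simp [ShallowNet.component, Matrix.one_apply, Matrix.diagonal_apply]
    exact Finset.sum_congr rfl fun i _ => by rw [← henc i, ← mul_assoc]; rfl
  rw [hnet]
  exact (ContinuousMap.dist_apply_le_dist (u, y)).trans_lt hFP
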